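/- **Setting.** Let $n\ge 1$, let $x_1,\dots,x_n$ be fixed points of a set $\mathcal X$, and let $f^\star:\mathcal X\to\mathbb R$ be any function. For $u,v\in\mathbb R^n$ put $\langle u,v\rangle_n=\frac1n\sum_{i=1}^n u_iv_i$ and $\|u\|_n=\langle u,u\rangle_n^{1/2}$; a function $f$ on $\mathcal X$ is identified in these expressions with the vector $f(x_1^n)=(f(x_1),\dots,f(x_n))$. Let $\mathcal F$ be a class of real-valued functions on $\mathcal X$ and let $\mathcal C\subseteq\mathbb R^n$ be a set such that $f(x_1^n)\in\mathcal C$ for at least one $f\in\mathcal F$. Let $\mathcal P(f)=0$ if $f(x_1^n)\in\mathcal C$ and $\mathcal P(f)=+\infty$ otherwise. Let $\mathcal M:\mathbb R^n\to\mathcal F$ be a method that selects, for every $y\in\mathbb R^n$, a minimizer $$\mathcal M(y)\in\arg\min_{f\in\mathcal F}\Big\{\tfrac1n\sum_{i=1}^n(y_i-f(x_i))^2+\mathcal P(f)\Big\}$$ (so these minimizers are assumed to exist), with each $y\mapsto \mathcal M(y)(x_i)$ measurable, and let $f^\dagger\in\arg\min_{f\in\mathcal F}\{\|f-f^\star\|_n^2+\mathcal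 P(f)\}$. The data are $y_i=f^\star(x_i)+w_i$, where $w_1,\dots,w_n$ are independent random variables, each with a distribution symmetric around $0$. Let $\varepsilon_1,\dots,\varepsilon_n$ be i.i.d. Rademacher variables (uniform on $\{-1,+1\}$), independent of $w=(w_1,\dots,w_n)$. Put $\widehat f=\mathcal M(y)$. Let $\widetilde f:\mathcal X\to\mathbb R$ be a recentering (pilot) predictor, possibly random and dependent on everything else, with residuals $\widetilde w_i=y_i-\widetilde f(x_i)$. For $\rho>0$ the wild refit is $f^{\diamond}_\rho=\mathcal M(y^\diamond)$ with $y^\diamond_i=\widehat f(x_i)+\rho\,\varepsilon_i\widetilde w_i$. The true optimism and the wild optimism are $$\mathrm{Opt}^\star(\widehat f)=\langle w,\widehat f-f^\star\rangle_n,\qquad \widetilde{\mathrm{Opt}}{}^{\diamond}(f^\diamond_\rho)=\frac1n\sum_{i=1}^n\varepsilon_i\widetilde w_i\big(f^\diamond_\rho(x_i)-\widehat f(x_i)\big).$$ **Theorem (wild optimism bound).** Let $r$ be a fixed (deterministic) radius and let $t>0$. Then there is an event of probability at least $1-4e^{-t^2}$ on which the following holds: if $\|\widehat f-f^\dagger\|_n\le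 r$, then for every noise scale $\rho>0$ with $\|f^\diamond_\rho-\widehat f\|_n=2r$, $$\mathrm{Opt}^\star(\widehat f)\;\le\;\widetilde{\mathrm{Opt}}{}^{\diamond}(f^\diamond_\rho)+\big\{H_n(t)+A_n(\widetilde f)\big\},$$ where the deviation term is $$H_n(t)=\big\{3r+\|f^\dagger-f^\star\|_n\big\}\,\frac{2\|w\|_\infty t}{\sqrt n},\qquad \|w\|_\infty=\max_{i}|w_i|,$$ and the pilot error is $$A_n(\widetilde f)=\sup\Big\{\frac1n\sum_{i=1}^n\varepsilon_i\big(\widetilde f(x_i)-f^\star(x_i)\big)\big(f(x_i)-\widehat f(x_i)\big)\;:\; f\in\mathcal F,\ f(x_1^n)\in\mathcal C,\ \|f-\widehat f\|_n\le 2r\Big\}.$$ -/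

import Mathlib

open MeasureTheory ProbabilityTheory

noncomputable section

namespace WildRefit

variable {X : Type*} {n : ℕ}

/-- The vector `f(x₁ⁿ) = (f(x₁), …, f(xₙ))` of values of `f` at the design points. -/
def vals (x : Fin n → X) (f : X → ℝ) : Fin n → ℝ := fun i => f (x i)

/-- The empirical inner product `⟨u, v⟩ₙ = (1/n) ∑ᵢ uᵢ vᵢ`. -/
def empInner (u v : Fin n → ℝ) : ℝ := (1 / (n : ℝ)) * ∑ i, u i * v i

/-- The empirical norm `‖u‖ₙ = ((1/n) ∑ᵢ uᵢ²)^{1/2}`. -/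
def empNorm (u : Fin n → ℝ) : ℝ := Real.sqrt ((1 / (n : ℝ)) * ∑ i, u i ^ 2)

open scoped Classical in
/-- The constraint penalty: `0` if `f(x₁ⁿ) ∈ C`, and `+∞` otherwise. -/
def penalty (x : Fin n → X) (C : Set (Fin n → ℝ)) (f : X → ℝ) : ENNReal :=
  if vals x f ∈ C then 0 else ⊤

/-- The penalized least-squares objective `(1/n) ∑ᵢ (yᵢ - f(xᵢ))² + P(f)`. -/
def objective (x : Fin n → X) (P : (X → ℝ) → ENNReal) (y : Fin n → ℝ) (f : X → ℝ) : ENNReal :=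
  ENNReal.ofReal ((1 / (n : ℝ)) * ∑ i, (y i - f (x i)) ^ 2) + P f

/-- `f ∈ argmin_{g ∈ F} { (1/n) ∑ᵢ (yᵢ - g(xᵢ))² + P(g) }`. -/
def IsPenalizedLS (x : Fin n → X) (F : Set (X → ℝ)) (P : (X → ℝ) → ENNReal)
    (y : Fin n → ℝ) (f : X → ℝ) : Prop :=
  f ∈ F ∧ ∀ g ∈ F, objective x P y f ≤ objective x P y g

/-- The ball of radius `s` around `g`, in the empirical norm, inside the functions of `F` that
have finite penalty. -/
def ball (x : Fin n → X) (F : Set (X → ℝ)) (P : (X → ℝ) → ENNReal)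
    (g : X → ℝ) (s : ℝ) : Set (X → ℝ) :=
  {f | f ∈ F ∧ P f ≠ ⊤ ∧ empNorm (vals x f - vals x g) ≤ s}

/-- The responses `yᵢ = f⋆(xᵢ) + wᵢ`. -/
def response (x : Fin n → X) (fstar : X → ℝ) (w : Fin n → ℝ) : Fin n → ℝ :=
  fun i => fstar (x i) + w i

/-- The residuals `w̃ᵢ = yᵢ - f̃(xᵢ)` with respect to the recentering predictor `f̃`. -/
def residual (x : Fin n → X) (y : Fin n → ℝ) (ftil : X → ℝ) : Fin n → ℝ :=
  fun i => y i - ftil (x i)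

/-- The wild refit `M(y°)` at noise scale `ρ`, where `y°ᵢ = f̂(xᵢ) + ρ εᵢ w̃ᵢ` and `f̂ = M(y)`. -/
def wildRefit (x : Fin n → X) (M : (Fin n → ℝ) → X → ℝ) (y : Fin n → ℝ) (ftil : X → ℝ)
    (ε : Fin n → ℝ) (ρ : ℝ) : X → ℝ :=
  M fun i => M y (x i) + ρ * ε i * residual x y ftil i

/-- The true optimism `⟨w, f̂ - f⋆⟩ₙ`. -/
def trueOptimism (x : Fin n → X) (w : Fin n → ℝ) (fhat fstar : X → ℝ) : ℝ :=
  empInner w (vals x fhat - vals x fstar)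

/-- The wild optimism `(1/n) ∑ᵢ εᵢ w̃ᵢ (f°_ρ(xᵢ) - f̂(xᵢ))`. -/
def wildOptimism (x : Fin n → X) (M : (Fin n → ℝ) → X → ℝ) (y : Fin n → ℝ) (ftil : X → ℝ)
    (ε : Fin n → ℝ) (ρ : ℝ) : ℝ :=
  empInner (fun i => ε i * residual x y ftil i)
    (vals x (wildRefit x M y ftil ε ρ) - vals x (M y))

/-- The pilot error
`sup { (1/n) ∑ᵢ εᵢ (f̃(xᵢ) - f⋆(xᵢ)) (f(xᵢ) - f̂(xᵢ)) : f ∈ ball(f̂, 2r) }`. -/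
def pilotError (x : Fin n → X) (F : Set (X → ℝ)) (P : (X → ℝ) → ENNReal)
    (fhat fstar ftil : X → ℝ) (ε : Fin n → ℝ) (r : ℝ) : ℝ :=
  sSup ((fun f : X → ℝ => empInner (fun i => ε i * (ftil (x i) - fstar (x i)))
    (vals x f - vals x fhat)) '' ball x F P fhat (2 * r))

/-- The deviation term `{3r + ‖f† - f⋆‖ₙ} · 2 ‖w‖_∞ t / √n`; `‖w‖` is the sup norm. -/
def deviation (x : Fin n → X) (fdag fstar : X → ℝ) (w : Fin n → ℝ) (r t : ℝ) : ℝ :=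
  (3 * r + empNorm (vals x fdag - vals x fstar)) * (2 * ‖w‖ * t / Real.sqrt n)

/-- `e` is a Rademacher variable: it takes each of the values `1` and `-1` with probability
`1/2`. -/
def IsRademacher {Ω : Type*} [MeasurableSpace Ω] (μ : Measure Ω) (e : Ω → ℝ) : Prop :=
  Measurable e ∧ μ {ω | e ω = 1} = 1 / 2 ∧ μ {ω | e ω = -1} = 1 / 2

/-- `e` has a distribution that is symmetric around zero. -/
def IsSymmetric {Ω : Type*} [MeasurableSpace Ω] (μ : Measure Ω) (e : Ω → ℝ) : Prop :=
  Measurable e ∧ μ.map e = μ.map (fun ω => -e ω)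

end WildRefit

end

/-! Split the true optimism as ⟨w, f̂ - f†⟩ + ⟨w, f† - f⋆⟩. The second term is linear in w with a
fixed direction; since w is symmetric, flipping signs turns it into a Rademacher sum with a Gaussian
tail. The first is at most Z(w), where Z(u) is the supremum of ⟨u, v⟩ over the differences v = f -
f† with f feasible and within r of f†.

The core is the comparison of Z(w) with Z(εw). Given the absolute values |w|, the sign vectors of w
and of εw are independent and uniform, so these are two independent copies of one Rademacher
supremum. It is convex and Lipschitz in the signs, and Maurey's inequality
(`sum_exp_mul_sum_exp_neg_le`) bounds E exp(lZ) · E exp(-lZ). That is the moment generating function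
of the difference of the copies, so one Chernoff bound suffices and no mean of Z appears.

Next, Z(εw) is recentred from f† to f̂. The cost is ⟨εw, f̂ - f†⟩, a Rademacher sum in ε because f̂
depends on w only. The ball moves into the ball of radius 2r around f̂, and w = w̃ + (f̃ - f⋆)
there. The f̃ - f⋆ part is at most the pilot error. The w̃ part is at most the wild optimism, since
a refit at distance exactly 2r maximizes the correlation with εw̃ over that ball
(`IsPenalizedLS.empInner_le`). -/

namespace WildRefit

/-! ### Sums over sign vectors -/

/-- The real vector of a sign vector. -/
def signVec {n : ℕ} (s : Fin n → ℤˣ) : Fin n → ℝ := fun i => ((s i : ℤ) : ℝ)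

lemma cast_unit_sq (s : ℤˣ) : ((s : ℤ) : ℝ) ^ 2 = 1 := by
  rcases Int.units_eq_one_or s with rfl | rfl <;> simp

lemma abs_cast_unit (s : ℤˣ) : |((s : ℤ) : ℝ)| = 1 := by
  rcases Int.units_eq_one_or s with rfl | rfl <;> simp

lemma sum_units_int (h : ℤˣ → ℝ) : ∑ s, h s = h 1 + h (-1) := by
  rw [UnitsInt.univ, Finset.sum_insert (by decide), Finset.sum_singleton]

lemma sum_signs_succ {n : ℕ} (h : (Fin (n + 1) → ℤˣ) → ℝ) :
    ∑ s, h s = ∑ s : Fin n → ℤˣ, h (Fin.cons 1 s) + ∑ s : Fin n → ℤˣ, h (Fin.cons (-1) s) := by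
  rw [← (Fin.consEquiv (fun _ : Fin (n + 1) => ℤˣ)).sum_comp, Fintype.sum_prod_type,
    sum_units_int]
  rfl

lemma card_signs (n : ℕ) : (Fintype.card (Fin n → ℤˣ) : ℝ) = 2 ^ n := by
  simp

/-! ### Maurey's inequality on the discrete cube -/

/-- Hölder's inequality for exponentials, normalized by logarithms. -/
lemma sum_exp_convex_comb_le {ι : Type*} [Fintype ι] [Nonempty ι] (a b : ι → ℝ) {θ : ℝ}
    (h0 : 0 ≤ θ) (h1 : θ ≤ 1) :
    ∑ i, Real.exp ((1 - θ) * a i + θ * b i) ≤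
      Real.exp ((1 - θ) * Real.log (∑ i, Real.exp (a i))
        + θ * Real.log (∑ i, Real.exp (b i))) := by
  have hA : 0 < ∑ i, Real.exp (a i) :=
    Finset.sum_pos (fun i _ => Real.exp_pos _) Finset.univ_nonempty
  have hB : 0 < ∑ i, Real.exp (b i) :=
    Finset.sum_pos (fun i _ => Real.exp_pos _) Finset.univ_nonempty
  set A := ∑ i, Real.exp (a i) with hAd
  set B := ∑ i, Real.exp (b i) with hBd
  have key : ∀ i, Real.exp ((1 - θ) * a i + θ * b i) ≤
      Real.exp ((1 - θ) * Real.log A + θ * Real.log B) *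
        ((1 - θ) * (Real.exp (a i) / A) + θ * (Real.exp (b i) / B)) := by
    intro i
    have h := convexOn_exp.2 (Set.mem_univ (a i - Real.log A)) (Set.mem_univ (b i - Real.log B))
      (sub_nonneg.2 h1) h0 (by ring)
    simp only [smul_eq_mul, Real.exp_sub, Real.exp_log hA, Real.exp_log hB] at h
    calc Real.exp ((1 - θ) * a i + θ * b i)
        = Real.exp ((1 - θ) * Real.log A + θ * Real.log B) *
          Real.exp ((1 - θ) * (a i - Real.log A) + θ * (b i - Real.log B)) := by
          rw [← Real.exp_add]; ring_nf
      _ ≤ _ := mul_le_mul_of_nonneg_left h (Real.exp_pos _).le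
  refine (Finset.sum_le_sum fun i _ => key i).trans (le_of_eq ?_)
  rw [← Finset.mul_sum, Finset.sum_add_distrib, ← Finset.mul_sum, ← Finset.mul_sum,
    ← Finset.sum_div, ← Finset.sum_div, ← hAd, ← hBd, div_self hA.ne', div_self hB.ne']
  ring

/-- The two-point case of Maurey's inequality, in scalar form. -/
lemma two_point_bound {d V : ℝ} (hd : 0 ≤ d)
    (hV : ∀ θ : ℝ, 0 ≤ θ → θ ≤ 1 → V ≤ Real.exp (θ ^ 2 / 4 + (1 - θ) * d)) :
    (1 + V) * (1 + Real.exp (-d)) ≤ 4 := by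
  have hpos := Real.exp_pos (-d)
  have exp_neg_le : ∀ u : ℝ, 0 ≤ u → Real.exp (-u) ≤ 1 - u + u ^ 2 / 2 := by
    intro u hu
    have h1 := Real.quadratic_le_exp_of_nonneg hu
    rw [Real.exp_neg, inv_le_iff_one_le_mul₀ (Real.exp_pos u)]
    have h2 : 0 ≤ 1 - u + u ^ 2 / 2 := by nlinarith [sq_nonneg (u - 1)]
    nlinarith [mul_le_mul_of_nonneg_left h1 h2, sq_nonneg (u ^ 2)]
  have exp_le : ∀ u : ℝ, 0 ≤ u → u ≤ 1 → Real.exp u ≤ 1 + u + u ^ 2 := by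
    intro u h0 h1
    have h := Real.abs_exp_sub_one_sub_id_le (x := u) (by rw [abs_of_nonneg h0]; exact h1)
    linarith [(abs_le.1 h).2]
  rcases le_total d (1 / 2) with h | h
  · have hv := hV (2 * d) (by linarith) (by linarith)
    have e1 : (2 * d) ^ 2 / 4 + (1 - 2 * d) * d = d - d ^ 2 := by ring
    rw [e1] at hv
    have hm : Real.exp (d - d ^ 2) * Real.exp (-d) = Real.exp (-d ^ 2) := by
      rw [← Real.exp_add]; ring_nf
    have b1 := exp_neg_le d hd
    have b2 := exp_neg_le (d ^ 2) (sq_nonneg d)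
    have b3 := exp_le (d - d ^ 2) (by nlinarith) (by nlinarith)
    have b4 : (1 + V) * (1 + Real.exp (-d)) ≤
        (1 + Real.exp (d - d ^ 2)) * (1 + Real.exp (-d)) := by gcongr
    -- This is exactly the margin below 4 left by the Taylor bounds `b1`, `b2`, `b3`.
    have b5 : 0 ≤ d ^ 2 * (1 / 2 + 2 * d - 3 / 2 * d ^ 2) := by
      apply mul_nonneg (sq_nonneg d); nlinarith
    nlinarith
  · have hv := hV 1 zero_le_one le_rfl
    have b1 := exp_le (1 / 4) (by norm_num) (by norm_num)
    have b2 := exp_neg_le (1 / 2) (by norm_num)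
    have b3 : Real.exp (-d) ≤ Real.exp (-(1 / 2)) := Real.exp_le_exp.2 (by linarith)
    have e1 : (1 : ℝ) ^ 2 / 4 + (1 - 1) * d = 1 / 4 := by ring
    rw [e1] at hv
    calc (1 + V) * (1 + Real.exp (-d)) ≤ (1 + 21 / 16) * (1 + Real.exp (-d)) := by
          gcongr; linarith
      _ ≤ (1 + 21 / 16) * (1 + 5 / 8) := by gcongr; linarith
      _ ≤ 4 := by norm_num

/-- Multiplying by `exp (-a)` leaves only the gap b - a. The half with the smaller exponent needs no
interpolation; the other one may move towards it. -/
lemma two_point_bound_of_le {a b U V : ℝ} (hab : a ≤ b) (hU : U ≤ Real.exp a)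
    (hV : ∀ θ : ℝ, 0 ≤ θ → θ ≤ 1 → V ≤ Real.exp (θ ^ 2 / 4 + ((1 - θ) * b + θ * a))) :
    (U + V) * (Real.exp (-a) + Real.exp (-b)) ≤ 4 := by
  have h := two_point_bound (d := b - a) (V := V * Real.exp (-a)) (sub_nonneg.2 hab) (by
    intro θ h0 h1
    have := mul_le_mul_of_nonneg_right (hV θ h0 h1) (Real.exp_pos (-a)).le
    rw [← Real.exp_add] at this
    refine this.trans (le_of_eq ?_)
    congr 1; ring)
  have e1 : Real.exp (-a) + Real.exp (-b) = Real.exp (-a) * (1 + Real.exp (-(b - a))) := by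
    rw [mul_add, ← Real.exp_add]; ring_nf
  have e2 : U * Real.exp (-a) ≤ 1 := by
    have := mul_le_mul_of_nonneg_right hU (Real.exp_pos (-a)).le
    rwa [← Real.exp_add, add_neg_cancel, Real.exp_zero] at this
  have hp := Real.exp_pos (-(b - a))
  rw [e1]
  calc (U + V) * (Real.exp (-a) * (1 + Real.exp (-(b - a))))
      = (U * Real.exp (-a) + V * Real.exp (-a)) * (1 + Real.exp (-(b - a))) := by ring
    _ ≤ (1 + V * Real.exp (-a)) * (1 + Real.exp (-(b - a))) := by gcongr
    _ ≤ 4 := h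

/-- The infimum convolution of `f` with the quadratic cost `|x - y|² / 16`. -/
noncomputable def infConv {n : ℕ} (f : (Fin n → ℝ) → ℝ) (x : Fin n → ℝ) : ℝ :=
  ⨅ y : Fin n → ℝ, (f y + 1 / 16 * ∑ i, (x i - y i) ^ 2)

lemma infConv_le {n : ℕ} {f : (Fin n → ℝ) → ℝ} (hf : ∀ y, 0 ≤ f y) (x y : Fin n → ℝ) :
    infConv f x ≤ f y + 1 / 16 * ∑ i, (x i - y i) ^ 2 := by
  refine ciInf_le ⟨0, ?_⟩ y
  rintro _ ⟨z, rfl⟩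
  have := hf z
  have : 0 ≤ ∑ i, (x i - z i) ^ 2 := Finset.sum_nonneg fun i _ => sq_nonneg _
  dsimp only
  linarith

/-- Evaluating a convex function on a chord with end points `cons s y₀` and `cons (-s) y₁`. -/
lemma le_infConv_comb {n : ℕ} {f : (Fin (n + 1) → ℝ) → ℝ} (hconv : ConvexOn ℝ Set.univ f)
    {g : (Fin (n + 1) → ℤˣ) → ℝ}
    (hg : ∀ s y, g s ≤ f y + 1 / 16 * ∑ i, (signVec s i - y i) ^ 2)
    (s : ℤˣ) (x : Fin n → ℤˣ) {θ : ℝ} (h0 : 0 ≤ θ) (h1 : θ ≤ 1) :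
    g (Fin.cons s x) ≤ θ ^ 2 / 4 +
      ((1 - θ) * infConv (fun y => f (Fin.cons ((s : ℤ) : ℝ) y)) (signVec x)
        + θ * infConv (fun y => f (Fin.cons (((-s : ℤˣ) : ℤ) : ℝ) y)) (signVec x)) := by
  set c : ℝ := ((s : ℤ) : ℝ) with hc
  have hc' : (((-s : ℤˣ) : ℤ) : ℝ) = -c := by simp [hc]
  rw [hc']
  have key : ∀ y z : Fin n → ℝ, g (Fin.cons s x) ≤ θ ^ 2 / 4 +
      ((1 - θ) * (f (Fin.cons c y) + 1 / 16 * ∑ i, (signVec x i - y i) ^ 2)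
        + θ * (f (Fin.cons (-c) z) + 1 / 16 * ∑ i, (signVec x i - z i) ^ 2)) := by
    intro y z
    have e1 := hg (Fin.cons s x) ((1 - θ) • (Fin.cons c y : Fin (n + 1) → ℝ)
      + θ • (Fin.cons (-c) z : Fin (n + 1) → ℝ))
    have e2 := hconv.2 (Set.mem_univ (Fin.cons c y : Fin (n + 1) → ℝ))
      (Set.mem_univ (Fin.cons (-c) z : Fin (n + 1) → ℝ)) (sub_nonneg.2 h1) h0 (by ring)
    simp only [smul_eq_mul] at e2
    have e3 : ∑ i, (signVec x i - ((1 - θ) * y i + θ * z i)) ^ 2 ≤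
        (1 - θ) * ∑ i, (signVec x i - y i) ^ 2 + θ * ∑ i, (signVec x i - z i) ^ 2 := by
      rw [Finset.mul_sum, Finset.mul_sum, ← Finset.sum_add_distrib]
      refine Finset.sum_le_sum fun i _ => ?_
      have : 0 ≤ θ * (1 - θ) * (y i - z i) ^ 2 :=
        mul_nonneg (mul_nonneg h0 (sub_nonneg.2 h1)) (sq_nonneg _)
      nlinarith
    have hcsq : c ^ 2 = 1 := cast_unit_sq s
    rw [Fin.sum_univ_succ] at e1
    simp only [signVec, Fin.cons_zero, Fin.cons_succ, Pi.add_apply, Pi.smul_apply,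
      smul_eq_mul, ← hc] at e1 e3 ⊢
    -- The first coordinate moves by 2θ, which at cost 1/16 gives the term θ²/4.
    have e4 : (c - ((1 - θ) * c + θ * -c)) ^ 2 = 4 * θ ^ 2 := by
      have : (c - ((1 - θ) * c + θ * -c)) ^ 2 = 4 * θ ^ 2 * c ^ 2 := by ring
      rw [this, hcsq, mul_one]
    rw [e4] at e1
    linarith
  have hstep : ∀ z : Fin n → ℝ, g (Fin.cons s x) ≤ θ ^ 2 / 4 +
      ((1 - θ) * infConv (fun y => f (Fin.cons c y)) (signVec x)
        + θ * (f (Fin.cons (-c) z) + 1 / 16 * ∑ i, (signVec x i - z i) ^ 2)) := by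
    intro z
    have : g (Fin.cons s x) - θ ^ 2 / 4
        - θ * (f (Fin.cons (-c) z) + 1 / 16 * ∑ i, (signVec x i - z i) ^ 2) ≤
        (1 - θ) * infConv (fun y => f (Fin.cons c y)) (signVec x) := by
      rw [infConv, Real.mul_iInf_of_nonneg (sub_nonneg.2 h1)]
      exact le_ciInf fun y => by linarith [key y z]
    linarith
  have : g (Fin.cons s x) - θ ^ 2 / 4
      - (1 - θ) * infConv (fun y => f (Fin.cons c y)) (signVec x) ≤
      θ * infConv (fun y => f (Fin.cons (-c) y)) (signVec x) := by
    generalize infConv (fun y => f (Fin.cons c y)) (signVec x) = I at hstep ⊢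
    rw [infConv, Real.mul_iInf_of_nonneg h0]
    exact le_ciInf fun z => by linarith [hstep z]
  linarith

lemma convexOn_cons {n : ℕ} {f : (Fin (n + 1) → ℝ) → ℝ} (hconv : ConvexOn ℝ Set.univ f) (c : ℝ) :
    ConvexOn ℝ Set.univ fun y : Fin n → ℝ => f (Fin.cons c y) := by
  refine ⟨convex_univ, fun y _ z _ a b ha hb hab => ?_⟩
  have h := hconv.2 (Set.mem_univ (Fin.cons c y : Fin (n + 1) → ℝ))
    (Set.mem_univ (Fin.cons c z : Fin (n + 1) → ℝ)) ha hb hab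
  have e : (Fin.cons c (a • y + b • z) : Fin (n + 1) → ℝ) =
      a • (Fin.cons c y : Fin (n + 1) → ℝ) + b • (Fin.cons c z : Fin (n + 1) → ℝ) := by
    funext i
    refine Fin.cases ?_ (fun j => ?_) i
    · simp [← add_mul, hab]
    · simp
  dsimp only
  rw [e]
  exact h

/-- Maurey's infimum-convolution inequality for convex functions and the uniform distribution
on sign vectors. -/
theorem sum_exp_mul_sum_exp_neg_le (n : ℕ) : ∀ (f : (Fin n → ℝ) → ℝ) (g : (Fin n → ℤˣ) → ℝ),
    ConvexOn ℝ Set.univ f → (∀ y, 0 ≤ f y) →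
    (∀ s y, g s ≤ f y + 1 / 16 * ∑ i, (signVec s i - y i) ^ 2) →
    (∑ s, Real.exp (g s)) * (∑ s, Real.exp (-f (signVec s))) ≤ (2 ^ n) ^ 2 := by
  induction n with
  | zero =>
    intro f g _ _ hg
    have h : ∀ s, g s + -f (signVec s) ≤ 0 := fun s => by
      simpa using hg s (signVec s)
    rw [Fintype.sum_unique, Fintype.sum_unique, ← Real.exp_add, pow_zero, one_pow,
      Real.exp_le_one_iff]
    exact h _
  | succ n ih =>
    intro f g hconv hf hg
    -- Slice along the first coordinate. The induction hypothesis controls the sums of `exp (-f)` on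
    -- each slice by `q`, and Hölder's inequality controls those of `exp g`, so only the two-point
    -- inequality for `q 1` and `q (-1)` remains.
    set φ : ℤˣ → (Fin n → ℝ) → ℝ := fun s y => f (Fin.cons ((s : ℤ) : ℝ) y) with hφ
    set q : ℤˣ → ℝ := fun s => Real.log (∑ x : Fin n → ℤˣ, Real.exp (infConv (φ s) (signVec x)))
      with hq
    have hqpos : ∀ s, 0 < ∑ x : Fin n → ℤˣ, Real.exp (infConv (φ s) (signVec x)) := fun s =>
      Finset.sum_pos (fun i _ => Real.exp_pos _) Finset.univ_nonempty
    have hA : ∀ s : ℤˣ, ∑ x : Fin n → ℤˣ, Real.exp (-f (signVec (Fin.cons s x))) ≤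
        (2 ^ n) ^ 2 * Real.exp (-q s) := by
      intro s
      have h := ih (φ s) (fun x => infConv (φ s) (signVec x)) (convexOn_cons hconv _)
        (fun y => hf _) (fun x y => infConv_le (fun y => hf _) _ _)
      rw [hq, Real.exp_neg, Real.exp_log (hqpos s), ← div_eq_mul_inv, le_div_iff₀ (hqpos s)]
      rw [mul_comm] at h
      refine le_trans (le_of_eq ?_) h
      congr 1
      refine Finset.sum_congr rfl fun x _ => ?_
      have : signVec (Fin.cons s x : Fin (n + 1) → ℤˣ) =
          (Fin.cons ((s : ℤ) : ℝ) (signVec x) : Fin (n + 1) → ℝ) := by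
        funext i
        refine Fin.cases ?_ (fun j => ?_) i <;> simp [signVec]
      rw [this]
    have hG : ∀ (s : ℤˣ) (θ : ℝ), 0 ≤ θ → θ ≤ 1 →
        ∑ x : Fin n → ℤˣ, Real.exp (g (Fin.cons s x)) ≤
          Real.exp (θ ^ 2 / 4 + ((1 - θ) * q s + θ * q (-s))) := by
      intro s θ h0 h1
      have h := sum_exp_convex_comb_le (fun x : Fin n → ℤˣ => infConv (φ s) (signVec x))
        (fun x : Fin n → ℤˣ => infConv (φ (-s)) (signVec x)) h0 h1
      rw [Real.exp_add]
      refine le_trans ?_ (mul_le_mul_of_nonneg_left h (Real.exp_pos _).le)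
      rw [Finset.mul_sum]
      refine Finset.sum_le_sum fun x _ => ?_
      rw [← Real.exp_add]
      exact Real.exp_le_exp.2 (le_infConv_comb hconv hg s x h0 h1)
    have hG0 : ∀ s : ℤˣ, ∑ x : Fin n → ℤˣ, Real.exp (g (Fin.cons s x)) ≤ Real.exp (q s) := by
      intro s
      simpa using hG s 0 le_rfl zero_le_one
    rw [sum_signs_succ, sum_signs_succ (fun s => Real.exp (-f (signVec s)))]
    set G := fun s : ℤˣ => ∑ x : Fin n → ℤˣ, Real.exp (g (Fin.cons s x))
    have hGn : ∀ s, 0 ≤ G s := fun s => Finset.sum_nonneg fun x _ => (Real.exp_pos _).le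
    have hmain : (G 1 + G (-1)) * (Real.exp (-q 1) + Real.exp (-q (-1))) ≤ 4 := by
      rcases le_total (q 1) (q (-1)) with h | h
      · exact two_point_bound_of_le h (hG0 1) (by simpa using hG (-1))
      · rw [add_comm (G 1), add_comm (Real.exp (-q 1))]
        exact two_point_bound_of_le h (hG0 (-1)) (by simpa using hG 1)
    calc (G 1 + G (-1)) * (∑ x : Fin n → ℤˣ, Real.exp (-f (signVec (Fin.cons 1 x)))
          + ∑ x : Fin n → ℤˣ, Real.exp (-f (signVec (Fin.cons (-1) x))))
        ≤ (G 1 + G (-1)) * ((2 ^ n) ^ 2 * Real.exp (-q 1) + (2 ^ n) ^ 2 * Real.exp (-q (-1))) :=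
          mul_le_mul_of_nonneg_left (add_le_add (hA 1) (hA (-1)))
            (add_nonneg (hGn 1) (hGn (-1)))
      _ = (2 ^ n) ^ 2 * ((G 1 + G (-1)) * (Real.exp (-q 1) + Real.exp (-q (-1)))) := by ring
      _ ≤ (2 ^ n) ^ 2 * 4 := by gcongr
      _ = (2 ^ (n + 1)) ^ 2 := by ring

/-! ### Chernoff bound -/

/-- Chernoff's bound for the uniform distribution on a finite type. -/
lemma sum_indicator_le_of_sum_exp_le {ι : Type*} [Fintype ι] (X : ι → ℝ) {a t : ℝ}
    (ha : 0 ≤ a) (ht : 0 < t)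
    (h : ∀ l : ℝ, 0 ≤ l →
      ∑ i, Real.exp (l * X i) ≤ Fintype.card ι * Real.exp (l ^ 2 * (a ^ 2 / 4)))
    (B : Set ι) (hB : ∀ i ∈ B, a * t < X i) :
    ∑ i, B.indicator (1 : ι → ℝ) i ≤ Fintype.card ι * Real.exp (-t ^ 2) := by
  rcases ha.eq_or_lt with rfl | ha
  · have hempty : B = ∅ := by
      refine Set.eq_empty_of_forall_notMem fun i hi => ?_
      have hX : 0 < X i := by simpa using hB i hi
      -- For a = 0 the exponential sum never exceeds the cardinality N, yet this multiplier makes a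
      -- single term equal to exp N > N.
      have h1 := h (Fintype.card ι / X i) (by positivity)
      have h2 : Real.exp (Fintype.card ι / X i * X i) ≤
          ∑ j, Real.exp (Fintype.card ι / X i * X j) :=
        Finset.single_le_sum (f := fun j => Real.exp (Fintype.card ι / X i * X j))
          (fun j _ => (Real.exp_pos _).le) (Finset.mem_univ i)
      rw [div_mul_cancel₀ _ hX.ne'] at h2
      have h3 := Real.add_one_le_exp (Fintype.card ι : ℝ)
      norm_num at h1
      linarith
    simp only [hempty, Set.indicator_empty, Finset.sum_const_zero]
    positivity
  -- The optimal multiplier: the exponent becomes -2t² + t².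
  · have h1 := h (2 * t / a) (by positivity)
    have h2 : ∀ i, B.indicator (1 : ι → ℝ) i ≤
        Real.exp (-(2 * t ^ 2)) * Real.exp (2 * t / a * X i) := by
      intro i
      by_cases hi : i ∈ B
      · rw [Set.indicator_of_mem hi, Pi.one_apply, ← Real.exp_add]
        refine Real.one_le_exp ?_
        have h3 : 2 * t / a * (a * t) ≤ 2 * t / a * X i :=
          mul_le_mul_of_nonneg_left (hB i hi).le (by positivity)
        have h4 : 2 * t / a * (a * t) = 2 * t ^ 2 := by field_simp
        linarith
      · rw [Set.indicator_of_notMem hi]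
        positivity
    calc ∑ i, B.indicator (1 : ι → ℝ) i
        ≤ ∑ i, Real.exp (-(2 * t ^ 2)) * Real.exp (2 * t / a * X i) :=
          Finset.sum_le_sum fun i _ => h2 i
      _ = Real.exp (-(2 * t ^ 2)) * ∑ i, Real.exp (2 * t / a * X i) := by rw [Finset.mul_sum]
      _ ≤ Real.exp (-(2 * t ^ 2)) *
          (Fintype.card ι * Real.exp ((2 * t / a) ^ 2 * (a ^ 2 / 4))) := by gcongr
      _ = Fintype.card ι * (Real.exp (-(2 * t ^ 2)) * Real.exp (t ^ 2)) := by
          have : (2 * t / a) ^ 2 * (a ^ 2 / 4) = t ^ 2 := by field_simp; ring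
          rw [this]; ring
      _ = Fintype.card ι * Real.exp (-t ^ 2) := by
          rw [← Real.exp_add]; ring_nf

/-! ### Empirical geometry, Rademacher sums and suprema -/

lemma empNorm_nonneg {n : ℕ} (u : Fin n → ℝ) : 0 ≤ empNorm u := Real.sqrt_nonneg _

lemma sq_empNorm {n : ℕ} (u : Fin n → ℝ) : empNorm u ^ 2 = 1 / (n : ℝ) * ∑ i, u i ^ 2 :=
  Real.sq_sqrt (mul_nonneg (by positivity) (Finset.sum_nonneg fun i _ => sq_nonneg _))

lemma empInner_le {n : ℕ} (u v : Fin n → ℝ) : empInner u v ≤ empNorm u * empNorm v := by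
  have h := Real.sum_mul_le_sqrt_mul_sqrt Finset.univ u v
  have hn : (0 : ℝ) ≤ 1 / n := by positivity
  rw [empInner, empNorm, empNorm, Real.sqrt_mul hn, Real.sqrt_mul hn]
  calc 1 / (n : ℝ) * ∑ i, u i * v i
      ≤ (√(1 / n) * √(1 / n)) * (√(∑ i, u i ^ 2) * √(∑ i, v i ^ 2)) := by
        rw [Real.mul_self_sqrt hn]; gcongr
    _ = _ := by ring

lemma empInner_add_left {n : ℕ} (u u' v : Fin n → ℝ) :
    empInner (u + u') v = empInner u v + empInner u' v := by
  simp only [empInner, Pi.add_apply, add_mul, Finset.sum_add_distrib, mul_add]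

lemma empInner_smul_left {n : ℕ} (c : ℝ) (u v : Fin n → ℝ) :
    empInner (c • u) v = c * empInner u v := by
  simp only [empInner, Pi.smul_apply, smul_eq_mul, mul_assoc, ← Finset.mul_sum]
  ring

lemma empInner_add_right {n : ℕ} (u v v' : Fin n → ℝ) :
    empInner u (v + v') = empInner u v + empInner u v' := by
  simp only [empInner, Pi.add_apply, mul_add, Finset.sum_add_distrib]

lemma empInner_zero_right {n : ℕ} (u : Fin n → ℝ) : empInner u 0 = 0 := by
  simp [empInner]

/-- The moment generating function of a Rademacher sum. -/
lemma sum_exp_empInner_signVec_le {n : ℕ} (u v : Fin n → ℝ) {K : ℝ}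
    (hu : ∀ i, |u i| ≤ K) (l : ℝ) :
    ∑ s : Fin n → ℤˣ, Real.exp (l * empInner (signVec s * u) v) ≤
      Fintype.card (Fin n → ℤˣ) *
        Real.exp (l ^ 2 * ((2 * K * empNorm v / √n) ^ 2 / 4)) := by
  have e1 : ∀ s : Fin n → ℤˣ, Real.exp (l * empInner (signVec s * u) v) =
      ∏ i, Real.exp (((s i : ℤ) : ℝ) * (l / n * (u i * v i))) := by
    intro s
    rw [← Real.exp_sum, empInner, ← mul_assoc, Finset.mul_sum]
    congr 1
    refine Finset.sum_congr rfl fun i _ => ?_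
    simp only [Pi.mul_apply, signVec]
    ring
  simp_rw [e1]
  -- Independence of the signs: the sum over the cube factors into two-point sums, each twice a
  -- hyperbolic cosine.
  rw [← Fintype.prod_sum fun (i : Fin n) (s : ℤˣ) =>
    Real.exp (((s : ℤ) : ℝ) * (l / n * (u i * v i)))]
  have e2 : ∀ i, ∑ s : ℤˣ, Real.exp (((s : ℤ) : ℝ) * (l / n * (u i * v i))) ≤
      2 * Real.exp ((l / n * (u i * v i)) ^ 2 / 2) := by
    intro i
    have h := Real.cosh_le_exp_half_sq (l / n * (u i * v i))
    rw [Real.cosh_eq] at h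
    rw [sum_units_int]
    simp only [Units.val_one, Int.cast_one, one_mul, Units.val_neg, Int.cast_neg, neg_mul]
    linarith
  refine (Finset.prod_le_prod (fun i _ => Finset.sum_nonneg fun s _ => (Real.exp_pos _).le)
    fun i _ => e2 i).trans ?_
  rw [Finset.prod_mul_distrib, ← Real.exp_sum, card_signs, Finset.prod_const, Finset.card_univ,
    Fintype.card_fin]
  gcongr
  have e3 : l ^ 2 * ((2 * K * empNorm v / √n) ^ 2 / 4) =
      ∑ i, (l / n) ^ 2 * (K ^ 2 * v i ^ 2) := by
    rw [div_pow, mul_pow _ (empNorm v), sq_empNorm, Real.sq_sqrt (Nat.cast_nonneg n),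
      ← Finset.mul_sum, ← Finset.mul_sum]
    ring
  rw [e3]
  refine Finset.sum_le_sum fun i _ => ?_
  have h1 : u i ^ 2 ≤ K ^ 2 := sq_le_sq' (by linarith [neg_abs_le (u i), hu i])
    ((le_abs_self _).trans (hu i))
  have h2 : 0 ≤ (l / n) ^ 2 * v i ^ 2 := by positivity
  have h3 := mul_le_mul_of_nonneg_left h1 h2
  have h4 : 0 ≤ (l / n) ^ 2 * v i ^ 2 * u i ^ 2 := by positivity
  -- The factor 1/2 from the cosh bound is given away here.
  nlinarith

/-- The support function of `T` with respect to the empirical inner product. -/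
noncomputable def supInner {n : ℕ} (T : Set (Fin n → ℝ)) (u : Fin n → ℝ) : ℝ :=
  ⨆ v : T, empInner u v

section supInner

variable {n : ℕ} {T : Set (Fin n → ℝ)} {r : ℝ}

lemma bddAbove_empInner (hT : ∀ v ∈ T, empNorm v ≤ r) (u : Fin n → ℝ) :
    BddAbove (Set.range fun v : T => empInner u v) := by
  refine ⟨empNorm u * r, ?_⟩
  rintro _ ⟨v, rfl⟩
  exact (empInner_le u v).trans (mul_le_mul_of_nonneg_left (hT v v.2) (empNorm_nonneg u))

lemma le_supInner (hT : ∀ v ∈ T, empNorm v ≤ r) (u : Fin n → ℝ) {v : Fin n → ℝ} (hv : v ∈ T) :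
    empInner u v ≤ supInner T u :=
  le_ciSup (bddAbove_empInner hT u) ⟨v, hv⟩

lemma supInner_le (h0 : 0 ∈ T) {u : Fin n → ℝ} {c : ℝ} (h : ∀ v ∈ T, empInner u v ≤ c) :
    supInner T u ≤ c := by
  have : Nonempty T := ⟨⟨0, h0⟩⟩
  exact ciSup_le fun v => h v v.2

lemma supInner_nonneg (hT : ∀ v ∈ T, empNorm v ≤ r) (h0 : 0 ∈ T) (u : Fin n → ℝ) :
    0 ≤ supInner T u := by
  simpa [empInner_zero_right] using le_supInner hT u h0

/-- A supremum of continuous functions is lower semicontinuous, so `T` may be uncountable. -/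
lemma measurable_supInner (hT : ∀ v ∈ T, empNorm v ≤ r) : Measurable (supInner T) := by
  refine LowerSemicontinuous.measurable ?_
  refine lowerSemicontinuous_ciSup (bddAbove_empInner hT) fun v => Continuous.lowerSemicontinuous ?_
  unfold empInner
  fun_prop

lemma convexOn_supInner_mul (hT : ∀ v ∈ T, empNorm v ≤ r) (h0 : 0 ∈ T) (w : Fin n → ℝ) :
    ConvexOn ℝ Set.univ fun s => supInner T (s * w) := by
  refine ⟨convex_univ, fun s _ s' _ a b ha hb _ => supInner_le h0 fun v hv => ?_⟩
  rw [add_mul, smul_mul_assoc, smul_mul_assoc, empInner_add_left, empInner_smul_left,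
    empInner_smul_left]
  exact add_le_add (mul_le_mul_of_nonneg_left (le_supInner hT _ hv) ha)
    (mul_le_mul_of_nonneg_left (le_supInner hT _ hv) hb)

/-- Cauchy–Schwarz gives the Lipschitz constant rK/√n in the Euclidean norm of the signs,
independently of the size of `T`. -/
lemma supInner_mul_le (hT : ∀ v ∈ T, empNorm v ≤ r) (h0 : 0 ∈ T)
    {w : Fin n → ℝ} {K : ℝ} (hK : 0 ≤ K) (hw : ∀ i, |w i| ≤ K) (s s' : Fin n → ℝ) :
    supInner T (s * w) ≤ supInner T (s' * w) + r * K / √n * √(∑ i, (s i - s' i) ^ 2) := by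
  refine supInner_le h0 fun v hv => ?_
  have e : s * w = s' * w + (s - s') * w := by ring
  rw [e, empInner_add_left]
  refine add_le_add (le_supInner hT _ hv) ((empInner_le _ _).trans ?_)
  have h1 : empNorm ((s - s') * w) ≤ K / √n * √(∑ i, (s i - s' i) ^ 2) := by
    refine Real.sqrt_le_iff.2 ⟨by positivity, ?_⟩
    rw [mul_pow, div_pow, Real.sq_sqrt (Nat.cast_nonneg n),
      Real.sq_sqrt (Finset.sum_nonneg fun i _ => sq_nonneg _), one_div_mul_eq_div,
      div_mul_eq_mul_div, Finset.mul_sum]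
    gcongr with i
    rw [Pi.mul_apply, Pi.sub_apply, mul_pow, mul_comm]
    gcongr ?_ * _
    exact sq_le_sq' (by linarith [neg_abs_le (w i), hw i]) ((le_abs_self _).trans (hw i))
  calc empNorm ((s - s') * w) * empNorm v
      ≤ (K / √n * √(∑ i, (s i - s' i) ^ 2)) * r :=
        mul_le_mul h1 (hT v hv) (empNorm_nonneg v) (by positivity)
    _ = _ := by ring

/-- Exponential concentration of the difference of two independent copies of a Rademacher
supremum. -/
lemma sum_exp_supInner_sub_le (hT : ∀ v ∈ T, empNorm v ≤ r) (h0 : 0 ∈ T)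
    {w : Fin n → ℝ} {K : ℝ} (hK : 0 ≤ K) (hw : ∀ i, |w i| ≤ K) {l : ℝ} (hl : 0 ≤ l) :
    (∑ s : Fin n → ℤˣ, Real.exp (l * supInner T (signVec s * w))) *
      (∑ s : Fin n → ℤˣ, Real.exp (-(l * supInner T (signVec s * w)))) ≤
      (2 ^ n) ^ 2 * Real.exp (l ^ 2 * ((4 * r * K / √n) ^ 2 / 4)) := by
  set c := l ^ 2 * ((4 * r * K / √n) ^ 2 / 4) with hc
  have h := sum_exp_mul_sum_exp_neg_le n (fun s => l * supInner T (s * w))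
    (fun s => l * supInner T (signVec s * w) - c)
    ((convexOn_supInner_mul hT h0 w).smul hl)
    (fun y => mul_nonneg hl (supInner_nonneg hT h0 _)) (by
      intro s y
      have h1 := mul_le_mul_of_nonneg_left (supInner_mul_le hT h0 hK hw (signVec s) y) hl
      set D := √(∑ i, (signVec s i - y i) ^ 2) with hD
      have h2 : ∑ i, (signVec s i - y i) ^ 2 = D ^ 2 :=
        (Real.sq_sqrt (Finset.sum_nonneg fun i _ => sq_nonneg _)).symm
      rw [h2]
      have h3 : c = 4 * (l * (r * K / √n)) ^ 2 := by rw [hc]; ring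
      rw [h3]
      -- Completing the square: αD - D²/16 ≤ 4α² with α = lrK/√n, which dictates the value of `c`.
      nlinarith [sq_nonneg (D / 4 - 2 * (l * (r * K / √n)))])
  simp_rw [Real.exp_sub] at h
  rw [← Finset.sum_div, div_mul_eq_mul_div, div_le_iff₀ (Real.exp_pos _)] at h
  exact h

end supInner

/-! ### Randomization by sign flips -/

/-- If a finite family of maps preserves a probability measure and a fraction at most `p` of the
images of almost every point lies in `B`, then `B` has probability at most `p`. -/
lemma measureReal_le_of_sum_indicator_le {E J : Type*} [MeasurableSpace E] (ν : Measure E)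
    [IsProbabilityMeasure ν] [Fintype J] [Nonempty J] (φ : J → E → E)
    (hφ : ∀ j, MeasurePreserving (φ j) ν ν) {B : Set E} (hB : MeasurableSet B) {p : ℝ}
    (h : ∀ᵐ z ∂ν, ∑ j, ((fun j => φ j z) ⁻¹' B).indicator (1 : J → ℝ) j ≤ Fintype.card J * p) :
    ν.real B ≤ p := by
  have hJ : (0 : ℝ) < Fintype.card J := by exact_mod_cast Fintype.card_pos
  have h1 : ∀ j, ν.real B = ∫ z, (φ j ⁻¹' B).indicator 1 z ∂ν := by
    intro j
    rw [integral_indicator_one ((hφ j).measurable hB), measureReal_def, measureReal_def,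
      (hφ j).measure_preimage hB.nullMeasurableSet]
  have hint : ∀ j, Integrable ((φ j ⁻¹' B).indicator (1 : E → ℝ)) ν := fun j =>
    (integrable_const (1 : ℝ)).indicator ((hφ j).measurable hB)
  have h2 : (Fintype.card J : ℝ) * ν.real B = ∫ z, ∑ j, (φ j ⁻¹' B).indicator 1 z ∂ν := by
    rw [integral_finsetSum _ fun j _ => hint j]
    simp_rw [← h1]
    simp
  have h3 : ∫ z, ∑ j, (φ j ⁻¹' B).indicator (1 : E → ℝ) z ∂ν ≤ ∫ _, Fintype.card J * p ∂ν := by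
    refine integral_mono_ae (integrable_finsetSum _ fun j _ => hint j) (integrable_const _) ?_
    filter_upwards [h] with z hz
    exact hz
  rw [← h2, integral_const, probReal_univ, one_smul] at h3
  exact le_of_mul_le_mul_left h3 hJ

lemma IsRademacher.neg {Ω : Type*} [MeasurableSpace Ω] {μ : Measure Ω} {e : Ω → ℝ}
    (he : IsRademacher μ e) : IsRademacher μ fun ω => -e ω := by
  refine ⟨he.1.neg, ?_, ?_⟩
  · simpa only [neg_eq_iff_eq_neg] using he.2.2
  · simpa only [neg_inj] using he.2.1

section Laws

variable {Ω : Type*} [MeasurableSpace Ω] {μ : Measure Ω} [IsProbabilityMeasure μ]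

lemma IsRademacher.ae_eq {e : Ω → ℝ} (he : IsRademacher μ e) : ∀ᵐ ω ∂μ, e ω = 1 ∨ e ω = -1 := by
  have m1 : MeasurableSet {ω | e ω = 1} := he.1 (measurableSet_singleton 1)
  have m2 : MeasurableSet {ω | e ω = -1} := he.1 (measurableSet_singleton (-1))
  have hd : Disjoint {ω | e ω = 1} {ω | e ω = -1} := by
    refine Set.disjoint_left.2 fun ω h1 h2 => ?_
    simp only [Set.mem_ofPred_eq] at h1 h2
    linarith
  have h : μ ({ω | e ω = 1} ∪ {ω | e ω = -1}) = 1 := by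
    rw [measure_union hd m2, he.2.1, he.2.2, ENNReal.add_halves]
  exact (prob_compl_eq_zero_iff (m1.union m2)).2 h

lemma IsRademacher.measure_preimage {e : Ω → ℝ} (he : IsRademacher μ e) (s : Set ℝ) :
    μ (e ⁻¹' s) =
      s.indicator (fun _ => (1 / 2 : ENNReal)) 1 + s.indicator (fun _ => (1 / 2 : ENNReal)) (-1) := by
  have m2 : MeasurableSet {ω | e ω = -1} := he.1 (measurableSet_singleton (-1))
  have hae : (e ⁻¹' s : Set Ω) =ᵐ[μ]
      (({ω | e ω = 1 ∧ (1 : ℝ) ∈ s} ∪ {ω | e ω = -1 ∧ (-1 : ℝ) ∈ s} : Set Ω)) := by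
    refine Filter.eventuallyEq_set.2 ?_
    filter_upwards [he.ae_eq] with ω hω
    rcases hω with h | h <;> norm_num [h]
  have hd : Disjoint {ω | e ω = 1 ∧ (1 : ℝ) ∈ s} {ω | e ω = -1 ∧ (-1 : ℝ) ∈ s} := by
    refine Set.disjoint_left.2 fun ω h1 h2 => ?_
    linarith [h1.1, h2.1]
  have m3 : MeasurableSet {ω | e ω = -1 ∧ (-1 : ℝ) ∈ s} := m2.inter (MeasurableSet.const _)
  rw [measure_congr hae, measure_union hd m3]
  congr 1
  · by_cases h : (1 : ℝ) ∈ s <;> simp [h, he.2.1]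
  · by_cases h : (-1 : ℝ) ∈ s <;> simp [h, he.2.2]

lemma IsRademacher.isSymmetric {e : Ω → ℝ} (he : IsRademacher μ e) : IsSymmetric μ e := by
  refine ⟨he.1, Measure.ext fun s hs => ?_⟩
  rw [Measure.map_apply he.1 hs, Measure.map_apply he.neg.1 hs, he.measure_preimage,
    he.neg.measure_preimage]

/-- Independent symmetric coordinates are invariant under sign flips. -/
lemma map_signVec_mul {n : ℕ} {u : Ω → Fin n → ℝ} (hs : ∀ i, IsSymmetric μ fun ω => u ω i)
    (hi : iIndepFun (fun i ω => u ω i) μ) (σ : Fin n → ℤˣ) :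
    μ.map (fun ω => signVec σ * u ω) = μ.map u := by
  have hm : ∀ i, Measurable fun ω => u ω i := fun i => (hs i).1
  have hi' : iIndepFun (fun i ω => signVec σ i * u ω i) μ :=
    hi.comp (fun i c => signVec σ i * c) fun i => measurable_const_mul _
  have h1 := (iIndepFun_iff_map_fun_eq_pi_map fun i => (hm i).aemeasurable).1 hi
  have h2 := (iIndepFun_iff_map_fun_eq_pi_map
    fun i => ((hm i).const_mul (signVec σ i)).aemeasurable).1 hi'
  have h3 : ∀ i, μ.map (fun ω => signVec σ i * u ω i) = μ.map fun ω => u ω i := by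
    intro i
    rcases Int.units_eq_one_or (σ i) with h | h
    · simp [signVec, h]
    · simpa [signVec, h] using (hs i).2.symm
  simp_rw [h3] at h2
  exact h2.trans h1.symm

/-- The joint law is a product, so the signs of noise and multipliers can be flipped separately.
This replaces conditioning on |w| or on w. -/
lemma measurePreserving_signVec_mul_prod {n : ℕ} {w ε : Ω → Fin n → ℝ}
    (hw : ∀ i, IsSymmetric μ fun ω => w ω i) (hwi : iIndepFun (fun i ω => w ω i) μ)
    (hε : ∀ i, IsSymmetric μ fun ω => ε ω i) (hεi : iIndepFun (fun i ω => ε ω i) μ)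
    (hwε : IndepFun w ε μ) (σ τ : Fin n → ℤˣ) :
    MeasurePreserving (fun p : (Fin n → ℝ) × (Fin n → ℝ) => (signVec σ * p.1, signVec τ * p.2))
      (μ.map fun ω => (w ω, ε ω)) (μ.map fun ω => (w ω, ε ω)) := by
  have hwm : Measurable w := measurable_pi_iff.2 fun i => (hw i).1
  have hεm : Measurable ε := measurable_pi_iff.2 fun i => (hε i).1
  have hmul : ∀ σ : Fin n → ℤˣ, Measurable fun v : Fin n → ℝ => signVec σ * v :=
    fun σ => measurable_const_mul _
  rw [(indepFun_iff_map_prod_eq_prod_map_map hwm.aemeasurable hεm.aemeasurable).1 hwε]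
  have := Measure.isProbabilityMeasure_map (μ := μ) hwm.aemeasurable
  have := Measure.isProbabilityMeasure_map (μ := μ) hεm.aemeasurable
  refine MeasurePreserving.prod ⟨hmul σ, ?_⟩ ⟨hmul τ, ?_⟩
  · rw [Measure.map_map (hmul σ) hwm]
    exact map_signVec_mul hw hwi σ
  · rw [Measure.map_map (hmul τ) hεm]
    exact map_signVec_mul hε hεi τ

end Laws

lemma exists_eq_signVec {n : ℕ} {e : Fin n → ℝ} (he : ∀ i, e i = 1 ∨ e i = -1) :
    ∃ η : Fin n → ℤˣ, e = signVec η := by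
  have : ∀ i, ∃ s : ℤˣ, e i = ((s : ℤ) : ℝ) := fun i => by
    rcases he i with h | h
    · exact ⟨1, by simp [h]⟩
    · exact ⟨-1, by simp [h]⟩
  choose η hη using this
  exact ⟨η, funext hη⟩

lemma signVec_mul {n : ℕ} (s s' : Fin n → ℤˣ) : signVec (s * s') = signVec s * signVec s' := by
  funext i; simp [signVec]

lemma signVec_one {n : ℕ} : signVec (1 : Fin n → ℤˣ) = 1 := by
  funext i; simp [signVec]

lemma abs_signVec_mul {n : ℕ} (s : Fin n → ℤˣ) (u : Fin n → ℝ) (i : Fin n) :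
    |(signVec s * u) i| = |u i| := by
  rw [Pi.mul_apply, abs_mul, signVec, abs_cast_unit, one_mul]

lemma norm_signVec_mul {n : ℕ} (s : Fin n → ℤˣ) (u : Fin n → ℝ) : ‖signVec s * u‖ = ‖u‖ := by
  have h : ∀ i, ‖(signVec s * u) i‖ = ‖u i‖ := fun i => abs_signVec_mul s u i
  refine le_antisymm ?_ ?_
  · exact (pi_norm_le_iff_of_nonneg (norm_nonneg _)).2 fun i => (h i).le.trans (norm_le_pi_norm u i)
  · exact (pi_norm_le_iff_of_nonneg (norm_nonneg _)).2 fun i =>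
      (h i).ge.trans (norm_le_pi_norm (signVec s * u) i)

/-! ### Tail bounds for the three bad events -/

section Measurability

variable {n : ℕ}

lemma measurableSet_noise_tail (v : Fin n → ℝ) (t : ℝ) :
    MeasurableSet {p : (Fin n → ℝ) × (Fin n → ℝ) |
      2 * ‖p.1‖ * empNorm v / √n * t < empInner p.1 v} := by
  refine measurableSet_lt (by fun_prop) ?_
  unfold empInner
  fun_prop

lemma measurableSet_rademacher_tail {V : (Fin n → ℝ) → Fin n → ℝ} (hV : Measurable V) (t : ℝ) :
    MeasurableSet {p : (Fin n → ℝ) × (Fin n → ℝ) |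
      2 * ‖p.1‖ * empNorm (V p.1) / √n * t < empInner (p.2 * p.1) (V p.1)} := by
  have hVi : ∀ i, Measurable fun p : (Fin n → ℝ) × (Fin n → ℝ) => V p.1 i :=
    measurable_pi_iff.1 (hV.comp measurable_fst)
  refine measurableSet_lt ?_ ?_
  · unfold empNorm
    fun_prop
  · unfold empInner
    simp only [Pi.mul_apply]
    fun_prop

lemma measurableSet_supInner_tail {T : Set (Fin n → ℝ)} {r : ℝ} (hT : ∀ v ∈ T, empNorm v ≤ r)
    (t : ℝ) :
    MeasurableSet {p : (Fin n → ℝ) × (Fin n → ℝ) |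
      4 * r * ‖p.1‖ / √n * t < supInner T p.1 - supInner T (p.2 * p.1)} :=
  measurableSet_lt (by fun_prop) (((measurable_supInner hT).comp measurable_fst).sub
    ((measurable_supInner hT).comp (measurable_snd.mul measurable_fst)))

end Measurability

section Events

variable {Ω : Type*} [MeasurableSpace Ω] {μ : Measure Ω} [IsProbabilityMeasure μ]
  {n : ℕ} {w ε : Ω → Fin n → ℝ}

/-- Off a null set ε lies in the sign group, so it can be absorbed by reindexing or into the
coefficients. -/
lemma ae_exists_signVec (hε_rad : ∀ i, IsRademacher μ fun ω => ε ω i) (hwm : Measurable w) :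
    ∀ᵐ p ∂(μ.map fun ω => (w ω, ε ω)), ∃ η : Fin n → ℤˣ, p.2 = signVec η := by
  have hεm : Measurable ε := measurable_pi_iff.2 fun i => (hε_rad i).1
  have hset : MeasurableSet
      {p : (Fin n → ℝ) × (Fin n → ℝ) | ∀ i, p.2 i = 1 ∨ p.2 i = -1} := by
    have : {p : (Fin n → ℝ) × (Fin n → ℝ) | ∀ i, p.2 i = 1 ∨ p.2 i = -1} =
        ⋂ i, (({p | p.2 i = 1} ∪ {p | p.2 i = -1} : Set ((Fin n → ℝ) × (Fin n → ℝ)))) := by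
      ext p; simp
    rw [this]
    refine MeasurableSet.iInter fun i => ?_
    have hm : Measurable fun p : (Fin n → ℝ) × (Fin n → ℝ) => p.2 i := by fun_prop
    exact (hm (measurableSet_singleton 1)).union (hm (measurableSet_singleton (-1)))
  have h : ∀ᵐ p ∂(μ.map fun ω => (w ω, ε ω)), ∀ i, p.2 i = 1 ∨ p.2 i = -1 := by
    rw [ae_map_iff (hwm.prodMk hεm).aemeasurable hset]
    exact ae_all_iff.2 fun i => (hε_rad i).ae_eq
  filter_upwards [h] with p hp
  exact exists_eq_signVec hp

/-- Tail bound for a fixed linear functional of the noise. -/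
lemma measureReal_noise_tail_le
    (hw_symm : ∀ i, IsSymmetric μ fun ω => w ω i)
    (hw_indep : iIndepFun (fun i ω => w ω i) μ)
    (hε_rad : ∀ i, IsRademacher μ fun ω => ε ω i)
    (hε_indep : iIndepFun (fun i ω => ε ω i) μ)
    (hwε : IndepFun w ε μ)
    (v : Fin n → ℝ) {t : ℝ} (ht : 0 < t) :
    (μ.map fun ω => (w ω, ε ω)).real
      {p | 2 * ‖p.1‖ * empNorm v / √n * t < empInner p.1 v} ≤ Real.exp (-t ^ 2) := by
  have hwm : Measurable w := measurable_pi_iff.2 fun i => (hw_symm i).1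
  have hεm : Measurable ε := measurable_pi_iff.2 fun i => (hε_rad i).1
  have := Measure.isProbabilityMeasure_map (μ := μ) (hwm.prodMk hεm).aemeasurable
  refine measureReal_le_of_sum_indicator_le _
    (fun (σ : Fin n → ℤˣ) (p : (Fin n → ℝ) × (Fin n → ℝ)) =>
      (signVec σ * p.1, signVec (1 : Fin n → ℤˣ) * p.2))
    (fun σ => measurePreserving_signVec_mul_prod hw_symm hw_indep
      (fun i => (hε_rad i).isSymmetric) hε_indep hwε σ 1) ?_ ?_
  · exact measurableSet_noise_tail v t
  · refine Filter.Eventually.of_forall fun p => ?_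
    refine sum_indicator_le_of_sum_exp_le (fun σ : Fin n → ℤˣ => empInner (signVec σ * p.1) v)
      (a := 2 * ‖p.1‖ * empNorm v / √n)
      (div_nonneg (mul_nonneg (by positivity) (empNorm_nonneg v)) (Real.sqrt_nonneg _)) ht
      (fun l _ => sum_exp_empInner_signVec_le _ _ (fun i => norm_le_pi_norm p.1 i) l) _ ?_
    intro σ hσ
    simpa only [Set.mem_preimage, Set.mem_ofPred_eq, norm_signVec_mul] using hσ

/-- Tail bound for a Rademacher sum whose coefficients depend on the noise only. -/
lemma measureReal_rademacher_tail_le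
    (hw_symm : ∀ i, IsSymmetric μ fun ω => w ω i)
    (hw_indep : iIndepFun (fun i ω => w ω i) μ)
    (hε_rad : ∀ i, IsRademacher μ fun ω => ε ω i)
    (hε_indep : iIndepFun (fun i ω => ε ω i) μ)
    (hwε : IndepFun w ε μ)
    {V : (Fin n → ℝ) → Fin n → ℝ} (hV : Measurable V)
    {t : ℝ} (ht : 0 < t) :
    (μ.map fun ω => (w ω, ε ω)).real
      {p | 2 * ‖p.1‖ * empNorm (V p.1) / √n * t < empInner (p.2 * p.1) (V p.1)} ≤
      Real.exp (-t ^ 2) := by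
  have hwm : Measurable w := measurable_pi_iff.2 fun i => (hw_symm i).1
  have hεm : Measurable ε := measurable_pi_iff.2 fun i => (hε_rad i).1
  have := Measure.isProbabilityMeasure_map (μ := μ) (hwm.prodMk hεm).aemeasurable
  -- Only ε is flipped: w, and with it the direction `V p.1`, stays fixed.
  refine measureReal_le_of_sum_indicator_le _
    (fun (τ : Fin n → ℤˣ) (p : (Fin n → ℝ) × (Fin n → ℝ)) =>
      (signVec (1 : Fin n → ℤˣ) * p.1, signVec τ * p.2))
    (fun τ => measurePreserving_signVec_mul_prod hw_symm hw_indep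
      (fun i => (hε_rad i).isSymmetric) hε_indep hwε 1 τ) ?_ ?_
  · exact measurableSet_rademacher_tail hV t
  · filter_upwards [ae_exists_signVec hε_rad hwm] with p hp
    obtain ⟨η, hη⟩ := hp
    refine sum_indicator_le_of_sum_exp_le
      (fun τ : Fin n → ℤˣ => empInner (signVec τ * (signVec η * p.1)) (V p.1))
      (a := 2 * ‖p.1‖ * empNorm (V p.1) / √n)
      (div_nonneg (mul_nonneg (by positivity) (empNorm_nonneg _)) (Real.sqrt_nonneg _)) ht
      (fun l _ => sum_exp_empInner_signVec_le _ _
        (fun i => (abs_signVec_mul η p.1 i).le.trans (norm_le_pi_norm p.1 i)) l) _ ?_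
    intro τ hτ
    simpa only [Set.mem_preimage, Set.mem_ofPred_eq, signVec_one, one_mul, hη, mul_assoc] using hτ

/-- Tail bound for the difference between the noise supremum and its Rademacher version. -/
lemma measureReal_supInner_tail_le
    (hw_symm : ∀ i, IsSymmetric μ fun ω => w ω i)
    (hw_indep : iIndepFun (fun i ω => w ω i) μ)
    (hε_rad : ∀ i, IsRademacher μ fun ω => ε ω i)
    (hε_indep : iIndepFun (fun i ω => ε ω i) μ)
    (hwε : IndepFun w ε μ)
    {T : Set (Fin n → ℝ)} {r : ℝ} (hT : ∀ v ∈ T, empNorm v ≤ r)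
    (h0 : 0 ∈ T) (hr : 0 ≤ r) {t : ℝ} (ht : 0 < t) :
    (μ.map fun ω => (w ω, ε ω)).real
      {p | 4 * r * ‖p.1‖ / √n * t < supInner T p.1 - supInner T (p.2 * p.1)} ≤
      Real.exp (-t ^ 2) := by
  have hwm : Measurable w := measurable_pi_iff.2 fun i => (hw_symm i).1
  have hεm : Measurable ε := measurable_pi_iff.2 fun i => (hε_rad i).1
  have := Measure.isProbabilityMeasure_map (μ := μ) (hwm.prodMk hεm).aemeasurable
  refine measureReal_le_of_sum_indicator_le _
    (fun (στ : (Fin n → ℤˣ) × (Fin n → ℤˣ)) (p : (Fin n → ℝ) × (Fin n → ℝ)) =>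
      (signVec στ.1 * p.1, signVec στ.2 * p.2))
    (fun στ => measurePreserving_signVec_mul_prod hw_symm hw_indep
      (fun i => (hε_rad i).isSymmetric) hε_indep hwε στ.1 στ.2) ?_ ?_
  · exact measurableSet_supInner_tail hT t
  · filter_upwards [ae_exists_signVec hε_rad hwm] with p hp
    obtain ⟨η, hη⟩ := hp
    refine sum_indicator_le_of_sum_exp_le
      (fun στ : (Fin n → ℤˣ) × (Fin n → ℤˣ) => supInner T (signVec στ.1 * p.1)
        - supInner T (signVec (στ.2 * (η * στ.1)) * p.1))
      (a := 4 * r * ‖p.1‖ / √n) (by positivity) ht ?_ _ ?_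
    · intro l hl
      have h := sum_exp_supInner_sub_le hT h0 (norm_nonneg p.1)
        (fun i => norm_le_pi_norm p.1 i) hl
      rw [Fintype.card_prod, Nat.cast_mul, card_signs, ← pow_two]
      refine le_trans (le_of_eq ?_) h
      rw [Fintype.sum_prod_type, Finset.sum_mul]
      refine Finset.sum_congr rfl fun σ _ => ?_
      -- The translation τ ↦ τησ makes the second sign vector range over the cube independently of
      -- σ, so the double sum is a product.
      rw [Finset.mul_sum,
        ← Equiv.sum_comp (Equiv.mulRight (η * σ))
          fun s => Real.exp (l * supInner T (signVec σ * p.1)) *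
            Real.exp (-(l * supInner T (signVec s * p.1)))]
      refine Finset.sum_congr rfl fun τ _ => ?_
      rw [← Real.exp_add, Equiv.coe_mulRight, mul_sub, sub_eq_add_neg]
    · intro στ hστ
      simpa only [Set.mem_preimage, Set.mem_ofPred_eq, norm_signVec_mul, signVec_mul, hη,
        mul_assoc] using hστ

end Events

/-! ### Deterministic inequalities for least squares -/

section Minimizers

variable {X : Type*} {n : ℕ} {x : Fin n → X} {F : Set (X → ℝ)} {C : Set (Fin n → ℝ)}

lemma penalty_ne_top_iff {f : X → ℝ} : penalty x C f ≠ ⊤ ↔ vals x f ∈ C := by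
  unfold penalty
  split_ifs with h <;> simp [h]

lemma IsPenalizedLS.vals_mem (hfeas : ∃ f ∈ F, vals x f ∈ C) {y : Fin n → ℝ} {f : X → ℝ}
    (hf : IsPenalizedLS x F (penalty x C) y f) : vals x f ∈ C := by
  obtain ⟨g, hgF, hgC⟩ := hfeas
  rw [← penalty_ne_top_iff]
  intro htop
  have h := hf.2 g hgF
  rw [objective, objective, htop, add_top, top_le_iff, ENNReal.add_eq_top] at h
  rcases h with h | h
  · exact ENNReal.ofReal_ne_top h
  · exact penalty_ne_top_iff.2 hgC h

lemma IsPenalizedLS.sq_le {y : Fin n → ℝ} {f : X → ℝ}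
    (hf : IsPenalizedLS x F (penalty x C) y f) (hfC : vals x f ∈ C) {g : X → ℝ}
    (hgF : g ∈ F) (hgC : vals x g ∈ C) :
    1 / (n : ℝ) * ∑ i, (y i - f (x i)) ^ 2 ≤ 1 / (n : ℝ) * ∑ i, (y i - g (x i)) ^ 2 := by
  have h := hf.2 g hgF
  simp only [objective, penalty, hfC, hgC, if_true, add_zero] at h
  exact (ENNReal.ofReal_le_ofReal_iff
    (mul_nonneg (by positivity) (Finset.sum_nonneg fun i _ => sq_nonneg _))).1 h

lemma sum_sq_perturb (a η : Fin n → ℝ) (ρ : ℝ) (h : Fin n → ℝ) :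
    1 / (n : ℝ) * ∑ i, (a i + ρ * η i - h i) ^ 2 =
      empNorm (h - a) ^ 2 - 2 * ρ * empInner η (h - a) + ρ ^ 2 * empNorm η ^ 2 := by
  rw [sq_empNorm, sq_empNorm, empInner]
  simp only [Finset.mul_sum, ← Finset.sum_sub_distrib, ← Finset.sum_add_distrib]
  refine Finset.sum_congr rfl fun i _ => ?_
  simp only [Pi.sub_apply]
  ring

/-- A least-squares refit to `a + ρ η` at distance `s` from `a` maximizes the correlation with
`η` among the feasible functions within distance `s` of `a`. -/
lemma IsPenalizedLS.empInner_le (hfeas : ∃ f ∈ F, vals x f ∈ C) {a η : Fin n → ℝ} {ρ s : ℝ}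
    (hρ : 0 < ρ) {f g : X → ℝ}
    (hf : IsPenalizedLS x F (penalty x C) (fun i => a i + ρ * η i) f)
    (hs : empNorm (vals x f - a) = s) (hgF : g ∈ F) (hgC : vals x g ∈ C)
    (hgs : empNorm (vals x g - a) ≤ s) :
    empInner η (vals x g - a) ≤ empInner η (vals x f - a) := by
  have h := hf.sq_le (hf.vals_mem hfeas) hgF hgC
  have e1 := sum_sq_perturb a η ρ (vals x f)
  have e2 := sum_sq_perturb a η ρ (vals x g)
  simp only [vals] at e1 e2 h
  rw [e1, e2] at h
  -- The quadratic term favours g, so the optimality of f can only come from the correlation term.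
  have h2 : empNorm (vals x g - a) ^ 2 ≤ empNorm (vals x f - a) ^ 2 := by
    rw [hs]
    exact pow_le_pow_left₀ (empNorm_nonneg _) hgs 2
  have h3 : ρ * empInner η (vals x g - a) ≤ ρ * empInner η (vals x f - a) := by
    linarith
  exact le_of_mul_le_mul_left h3 hρ

lemma le_pilotError {fhat fstar ftil : X → ℝ} {e : Fin n → ℝ} {r : ℝ} {f : X → ℝ}
    (hf : f ∈ ball x F (penalty x C) fhat (2 * r)) :
    empInner (fun i => e i * (ftil (x i) - fstar (x i))) (vals x f - vals x fhat) ≤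
      pilotError x F (penalty x C) fhat fstar ftil e r := by
  -- Cauchy–Schwarz bounds the set, so the real `sSup` is a true supremum and not its default 0.
  refine le_csSup ⟨empNorm (fun i => e i * (ftil (x i) - fstar (x i))) * (2 * r), ?_⟩ ⟨f, hf, rfl⟩
  rintro _ ⟨g, hg, rfl⟩
  exact (WildRefit.empInner_le _ _).trans
    (mul_le_mul_of_nonneg_left hg.2.2 (empNorm_nonneg _))

/-- The Rademacher process of the noise over the ball is dominated by the wild optimism and the
pilot error. -/
lemma empInner_mul_le_wildOptimism_add (hfeas : ∃ f ∈ F, vals x f ∈ C)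
    {M : (Fin n → ℝ) → X → ℝ} (hM : ∀ y, IsPenalizedLS x F (penalty x C) y (M y))
    {fstar ftil : X → ℝ} {w e : Fin n → ℝ} {r ρ : ℝ} (hρ : 0 < ρ) {y : Fin n → ℝ}
    (hy : y = response x fstar w)
    (hs : empNorm (vals x (wildRefit x M y ftil e ρ) - vals x (M y)) = 2 * r)
    {f : X → ℝ} (hf : f ∈ ball x F (penalty x C) (M y) (2 * r)) :
    empInner (e * w) (vals x f - vals x (M y)) ≤
      wildOptimism x M y ftil e ρ + pilotError x F (penalty x C) (M y) fstar ftil e r := by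
  have hrefit : IsPenalizedLS x F (penalty x C)
      (fun i => vals x (M y) i + ρ * (e i * residual x y ftil i)) (wildRefit x M y ftil e ρ) := by
    simpa only [wildRefit, vals, mul_assoc] using
      hM fun i => M y (x i) + ρ * e i * residual x y ftil i
  have h1 := IsPenalizedLS.empInner_le hfeas (η := fun i => e i * residual x y ftil i)
    hρ hrefit hs hf.1 (penalty_ne_top_iff.1 hf.2.1) hf.2.2
  have h2 := le_pilotError (fstar := fstar) (ftil := ftil) (e := e) hf
  have h3 : e * w = (fun i => e i * residual x y ftil i)
      + fun i => e i * (ftil (x i) - fstar (x i)) := by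
    funext i
    simp only [Pi.mul_apply, Pi.add_apply, residual, hy, response]
    ring
  rw [h3, empInner_add_left]
  exact add_le_add h1 h2

end Minimizers

lemma empNorm_sub_le {n : ℕ} (u v z : Fin n → ℝ) :
    empNorm (u - z) ≤ empNorm (u - v) + empNorm (v - z) := by
  refine abs_le_of_sq_le_sq' ?_ (add_nonneg (empNorm_nonneg _) (empNorm_nonneg _)) |>.2
  have h := empInner_le (u - v) (v - z)
  have e : empNorm (u - z) ^ 2 =
      empNorm (u - v) ^ 2 + 2 * empInner (u - v) (v - z) + empNorm (v - z) ^ 2 := by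
    simp only [sq_empNorm, empInner, Finset.mul_sum, ← Finset.sum_add_distrib, Pi.sub_apply]
    exact Finset.sum_congr rfl fun i _ => by ring
  rw [e]
  nlinarith

lemma empNorm_sub_comm {n : ℕ} (u v : Fin n → ℝ) : empNorm (u - v) = empNorm (v - u) := by
  simp only [empNorm, Pi.sub_apply, sub_sq_comm]

end WildRefit

/-! ### The wild optimism bound -/

open WildRefit

theorem theorem1 {Ω X : Type*} [MeasurableSpace Ω] (μ : Measure Ω) [IsProbabilityMeasure μ]
    {n : ℕ} (hn : 0 < n) (x : Fin n → X) (fstar : X → ℝ)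
    -- the function class, the constraint set and the prediction method
    (F : Set (X → ℝ)) (C : Set (Fin n → ℝ)) (hfeas : ∃ f ∈ F, WildRefit.vals x f ∈ C)
    (M : (Fin n → ℝ) → X → ℝ)
    (hM : ∀ y, WildRefit.IsPenalizedLS x F (WildRefit.penalty x C) y (M y))
    (hMmeas : ∀ i, Measurable fun y => M y (x i))
    -- the noiseless solution
    (fdag : X → ℝ)
    (hdag : WildRefit.IsPenalizedLS x F (WildRefit.penalty x C) (WildRefit.vals x fstar) fdag)
    -- the noise and the random signs
    (w ε : Ω → Fin n → ℝ)
    (hw_symm : ∀ i, WildRefit.IsSymmetric μ fun ω => w ω i)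
    (hw_indep : iIndepFun (fun i ω => w ω i) μ)
    (hε_rad : ∀ i, WildRefit.IsRademacher μ fun ω => ε ω i)
    (hε_indep : iIndepFun (fun i ω => ε ω i) μ)
    (hwε : IndepFun w ε μ)
    -- the recentering predictor, possibly random
    (ftil : Ω → X → ℝ)
    (r t : ℝ) (ht : 0 < t) :
    ∃ E : Set Ω, MeasurableSet E ∧ 1 - 4 * Real.exp (-t ^ 2) ≤ μ.real E ∧
      ∀ ω ∈ E, ∀ (y : Fin n → ℝ) (fhat : X → ℝ),
        y = WildRefit.response x fstar (w ω) → fhat = M y →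
        WildRefit.empNorm (WildRefit.vals x fhat - WildRefit.vals x fdag) ≤ r →
        ∀ ρ : ℝ, 0 < ρ →
          WildRefit.empNorm (WildRefit.vals x (WildRefit.wildRefit x M y (ftil ω) (ε ω) ρ)
            - WildRefit.vals x fhat) = 2 * r →
          WildRefit.trueOptimism x (w ω) fhat fstar ≤
            WildRefit.wildOptimism x M y (ftil ω) (ε ω) ρ
              + (WildRefit.deviation x fdag fstar (w ω) r t
                + WildRefit.pilotError x F (WildRefit.penalty x C) fhat fstar (ftil ω) (ε ω) r) :=
  by
  have hexp := Real.exp_pos (-t ^ 2)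
  -- For r < 0 no f̂ satisfies the distance hypothesis.
  rcases lt_or_ge r 0 with hr | hr
  · refine ⟨Set.univ, MeasurableSet.univ, by rw [probReal_univ]; linarith, ?_⟩
    intro ω _ y fhat _ _ hle
    exact absurd (empNorm_nonneg _) (not_le.2 (hle.trans_lt hr))
  have hdagC := hdag.vals_mem hfeas
  set T : Set (Fin n → ℝ) :=
    (fun f => vals x f - vals x fdag) '' ball x F (penalty x C) fdag r with hTdef
  have hT : ∀ v ∈ T, empNorm v ≤ r := by
    rintro _ ⟨f, hf, rfl⟩
    exact hf.2.2
  have h0 : 0 ∈ T :=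
    ⟨fdag, ⟨hdag.1, penalty_ne_top_iff.2 hdagC, by simpa [empNorm] using hr⟩, sub_self _⟩
  set V : (Fin n → ℝ) → Fin n → ℝ :=
    fun u => vals x (M (response x fstar u)) - vals x fdag with hVdef
  have hV : Measurable V := by
    refine measurable_pi_iff.2 fun i => Measurable.sub ?_ measurable_const
    refine (hMmeas i).comp (measurable_pi_iff.2 fun j => ?_)
    simp only [response]
    fun_prop
  -- The bad events involve only (w, ε), neither f̃ nor ρ. Hence the pilot may be arbitrary and the
  -- bound is uniform in ρ.
  set B₁ : Set ((Fin n → ℝ) × (Fin n → ℝ)) :=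
    {p | 2 * ‖p.1‖ * empNorm (vals x fdag - vals x fstar) / √n * t <
      empInner p.1 (vals x fdag - vals x fstar)} with hB₁
  set B₂ : Set ((Fin n → ℝ) × (Fin n → ℝ)) :=
    {p | 2 * ‖p.1‖ * empNorm (V p.1) / √n * t < empInner (p.2 * p.1) (V p.1)} with hB₂
  set B₃ : Set ((Fin n → ℝ) × (Fin n → ℝ)) :=
    {p | 4 * r * ‖p.1‖ / √n * t < supInner T p.1 - supInner T (p.2 * p.1)} with hB₃
  have p₁ : (μ.map fun ω => (w ω, ε ω)).real B₁ ≤ _ :=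
    measureReal_noise_tail_le hw_symm hw_indep hε_rad hε_indep hwε _ ht
  have p₂ : (μ.map fun ω => (w ω, ε ω)).real B₂ ≤ _ :=
    measureReal_rademacher_tail_le hw_symm hw_indep hε_rad hε_indep hwε hV ht
  have p₃ : (μ.map fun ω => (w ω, ε ω)).real B₃ ≤ _ :=
    measureReal_supInner_tail_le hw_symm hw_indep hε_rad hε_indep hwε hT h0 hr ht
  have hwm : Measurable w := measurable_pi_iff.2 fun i => (hw_symm i).1
  have hεm : Measurable ε := measurable_pi_iff.2 fun i => (hε_rad i).1
  have hmeas := hwm.prodMk hεm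
  have := Measure.isProbabilityMeasure_map (μ := μ) hmeas.aemeasurable
  have hBm : MeasurableSet (B₁ ∪ B₂ ∪ B₃) :=
    ((measurableSet_noise_tail _ t).union (measurableSet_rademacher_tail hV t)).union
      (measurableSet_supInner_tail hT t)
  refine ⟨(fun ω => (w ω, ε ω)) ⁻¹' (B₁ ∪ B₂ ∪ B₃)ᶜ, hmeas hBm.compl, ?_, ?_⟩
  · rw [← map_measureReal_apply hmeas hBm.compl, probReal_compl_eq_one_sub hBm]
    -- Three events are removed, so one of the four terms exp(-t²) is spare.
    have u₁ := measureReal_union_le (μ := μ.map fun ω => (w ω, ε ω)) (B₁ ∪ B₂) B₃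
    have u₂ := measureReal_union_le (μ := μ.map fun ω => (w ω, ε ω)) B₁ B₂
    linarith
  intro ω hω y fhat hy hfhat hle ρ hρ hs
  simp only [Set.mem_preimage, Set.mem_compl_iff, Set.mem_union, not_or, hB₁, hB₂, hB₃,
    Set.mem_ofPred_eq, not_lt] at hω
  obtain ⟨⟨b₁, b₂⟩, b₃⟩ := hω
  have hVw : V (w ω) = vals x fhat - vals x fdag := by rw [hVdef, hfhat, hy]
  rw [hVw] at b₂
  subst hfhat
  have hMC := (hM y).vals_mem hfeas
  have hmem : vals x (M y) - vals x fdag ∈ T :=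
    ⟨M y, ⟨(hM y).1, penalty_ne_top_iff.2 hMC, hle⟩, rfl⟩
  have c₁ := le_supInner hT (w ω) hmem
  have c₂ : supInner T (ε ω * w ω) ≤ wildOptimism x M y (ftil ω) (ε ω) ρ
      + pilotError x F (penalty x C) (M y) fstar (ftil ω) (ε ω) r
      + empInner (ε ω * w ω) (vals x (M y) - vals x fdag) := by
    refine supInner_le h0 ?_
    rintro _ ⟨f, hf, rfl⟩
    have hfb : f ∈ ball x F (penalty x C) (M y) (2 * r) := by
      refine ⟨hf.1, hf.2.1, ?_⟩
      have := empNorm_sub_le (vals x f) (vals x fdag) (vals x (M y))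
      rw [empNorm_sub_comm (vals x fdag)] at this
      linarith [hf.2.2]
    have := empInner_mul_le_wildOptimism_add hfeas hM hρ hy hs hfb
    have e : vals x f - vals x fdag =
        (vals x f - vals x (M y)) + (vals x (M y) - vals x fdag) := by abel
    simp only [e, empInner_add_right]
    linarith
  have c₃ : trueOptimism x (w ω) (M y) fstar = empInner (w ω) (vals x (M y) - vals x fdag)
      + empInner (w ω) (vals x fdag - vals x fstar) := by
    rw [← empInner_add_right, trueOptimism]
    congr 1
    abel
  have c₄ : 2 * ‖w ω‖ * empNorm (vals x (M y) - vals x fdag) / √n * t ≤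
      2 * ‖w ω‖ * r / √n * t := by gcongr
  -- The 3r is one r from recentring at f̂ and two from comparing the suprema, in units of 2‖w‖t/√n.
  have c₅ : deviation x fdag fstar (w ω) r t = 2 * ‖w ω‖ * r / √n * t + 4 * r * ‖w ω‖ / √n * t
      + 2 * ‖w ω‖ * empNorm (vals x fdag - vals x fstar) / √n * t := by
    rw [deviation]; ring
  rw [c₃, c₅]
  linarith
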